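/- Let $\mathcal{M}=(S,\mathit{Act},P,s_{\mathrm{init}})$ be a finite Markov decision process: $S$ and $\mathit{Act}$ are finite, $P\colon S\times \mathit{Act}\times S\to[0,1]\cap\mathbb{Q}$ satisfies $\sum_{t}P(s,\alpha,t)\in\{0,1\}$ for all $(s,\alpha)$, action $\alpha$ is enabled in $s$ if this sum is $1$, and every state has an enabled action. Let $T\subseteq S$ be a set of absorbing states (that is, $P(t,\alpha,t)=1$ for all $t\in T$ and all $\alpha$ enabled in $t$), and let $\mathit{wgt}\colon T\to\mathbb{Q}$. For an infinite path $\pi$, let $\mathrm{WR}(\pi)=\mathit{wgt}(t)$ if $\pi$ reaches $t\in T$, and $\mathrm{WR}(\pi)=0$ if $\pi$ does not reach $T$. A scheduler assigns to every finite path a probability distribution over the actions enabled in its last state; it is memoryless if this distribution depends only on the last state of the path, and deterministic if it is always a Dirac distribution. For schedulers $\mathfrak{S},\mathfrak{T}$ of $\mathcal{M}$, the product scheduler $\mathfrak{S}\otimes\mathfrak{T}$ of the synchronous product $\mathcal{M}\otimes\mathcal{M}$ (whose transition probabilities are the products of those of the components) resolves the two components independently. Put $$\mathbb{V}^{\mathfrak{S},\mathfrak{T}}_{\mathcal{M}}(\mathrm{WR})=\tfrac12\,\mathbb{E}^{\mathfrak{S}\otimes\mathfrak{T}}_{\mathcal{M}\otimes\mathcal{M}}\big((\mathrm{WR}_1-\mathrm{WR}_2)^2\big),\qquad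 \mathbb{V}^{\mathit{dem}}_{\mathcal{M}}(\mathrm{WR})=\sup_{\mathfrak{S},\mathfrak{T}}\mathbb{V}^{\mathfrak{S},\mathfrak{T}}_{\mathcal{M}}(\mathrm{WR}),$$ where the expectation is taken from the initial state $(s_{\mathrm{init}},s_{\mathrm{init}})$, $\mathrm{WR}_i$ is $\mathrm{WR}$ applied to the $i$-th component of a path of $\mathcal{M}\otimes\mathcal{M}$, and the supremum ranges over all pairs of (history-dependent, randomized) schedulers of $\mathcal{M}$. Then there are memoryless deterministic schedulers $\mathfrak{S}$ and $\mathfrak{T}$ for $\mathcal{M}$ such that $$\mathbb{V}^{\mathit{dem}}_{\mathcal{M}}(\mathrm{WR})=\mathbb{V}^{\mathfrak{S},\mathfrak{T}}_{\mathcal{M}}(\mathrm{WR}).$$ -/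

import Mathlib

open MeasureTheory ProbabilityTheory

/-- A Markov decision process with finite state set `S` and finite action set `Act`: rational
transition probabilities whose sum over the successors is `0` or `1` for every state-action pair,
an initial state, and at least one enabled action in every state. -/
structure MDP (S Act : Type*) [Fintype S] [Fintype Act] where
  P : S → Act → S → ℚ
  init : S
  P_nonneg : ∀ s a t, 0 ≤ P s a t
  P_sum : ∀ s a, ∑ t, P s a t = 0 ∨ ∑ t, P s a t = 1
  exists_enabled : ∀ s, ∃ a, ∑ t, P s a t = 1

/-- A finite alternating sequence `s₀ α₀ s₁ α₁ … s_k`, stored as its first state `s₀` and the list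
of steps `(α₀, s₁), …, (α_{k-1}, s_k)`. -/
structure FinPath (S Act : Type*) where
  start : S
  steps : List (Act × S)

/-- An infinite alternating sequence `s₀ α₀ s₁ α₁ …`, stored as its first state `s₀` and the
sequence of steps `(α₀, s₁), (α₁, s₂), …`. -/
abbrev InfPath (S Act : Type*) := S × (ℕ → Act × S)

namespace FinPath

variable {S Act S' Act' : Type*}

/-- The last state `s_k`. -/
def last (π : FinPath S Act) : S := (π.steps.getLast?.map Prod.snd).getD π.start

/-- Projection to the first component of a sequence of pairs. -/
def fst (π : FinPath (S × S') (Act × Act')) : FinPath S Act :=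
  ⟨π.start.1, π.steps.map fun p => (p.1.1, p.2.1)⟩

/-- Projection to the second component of a sequence of pairs. -/
def snd (π : FinPath (S × S') (Act × Act')) : FinPath S' Act' :=
  ⟨π.start.2, π.steps.map fun p => (p.1.2, p.2.2)⟩

lemma last_fst (π : FinPath (S × S') (Act × Act')) : π.fst.last = π.last.1 := by
  simp only [last, fst, List.getLast?_map]
  cases π.steps.getLast? <;> simp

lemma last_snd (π : FinPath (S × S') (Act × Act')) : π.snd.last = π.last.2 := by
  simp only [last, snd, List.getLast?_map]
  cases π.steps.getLast? <;> simp

end FinPath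

namespace InfPath

variable {S Act S' Act' : Type*}

/-- The state `s_n` of an infinite sequence. -/
def state (π : InfPath S Act) : ℕ → S
  | 0 => π.1
  | n + 1 => (π.2 n).2

/-- Projection to the first component of a sequence of pairs. -/
def fst (π : InfPath (S × S') (Act × Act')) : InfPath S Act :=
  (π.1.1, fun n => ((π.2 n).1.1, (π.2 n).2.1))

/-- Projection to the second component of a sequence of pairs. -/
def snd (π : InfPath (S × S') (Act × Act')) : InfPath S' Act' :=
  (π.1.2, fun n => ((π.2 n).1.2, (π.2 n).2.2))

end InfPath

namespace MDP

variable {S Act S' Act' : Type*} [Fintype S] [Fintype Act] [Fintype S'] [Fintype Act']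

/-- Action `a` is enabled in state `s`. -/
def Enabled (M : MDP S Act) (s : S) (a : Act) : Prop := ∑ t, M.P s a t = 1

/-- State `s` is absorbing: every enabled action loops with probability one. -/
def Absorbing (M : MDP S Act) (s : S) : Prop := ∀ a, M.Enabled s a → M.P s a s = 1

lemma sum_mul_prod (M : MDP S Act) (N : MDP S' Act') (s : S × S') (a : Act × Act') :
    ∑ t : S × S', M.P s.1 a.1 t.1 * N.P s.2 a.2 t.2 =
      (∑ t, M.P s.1 a.1 t) * ∑ t, N.P s.2 a.2 t := by
  rw [Fintype.sum_prod_type, Finset.sum_mul_sum]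

/-- The synchronous product of two MDPs. -/
def prod (M : MDP S Act) (N : MDP S' Act') : MDP (S × S') (Act × Act') where
  P s a t := M.P s.1 a.1 t.1 * N.P s.2 a.2 t.2
  init := (M.init, N.init)
  P_nonneg _ _ _ := mul_nonneg (M.P_nonneg _ _ _) (N.P_nonneg _ _ _)
  P_sum s a := by
    rw [sum_mul_prod]
    rcases M.P_sum s.1 a.1 with h | h <;> rcases N.P_sum s.2 a.2 with h' | h' <;> simp [h, h']
  exists_enabled s := by
    obtain ⟨a, ha⟩ := M.exists_enabled s.1
    obtain ⟨b, hb⟩ := N.exists_enabled s.2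
    exact ⟨(a, b), by rw [sum_mul_prod, ha, hb, one_mul]⟩

/-- A history-dependent randomized scheduler: it assigns to each finite path a probability
distribution over the actions enabled in its last state. It is total on alternating sequences of
states and actions; its values on sequences containing a transition of probability zero
have no influence on the induced measure. -/
structure Scheduler (M : MDP S Act) where
  choice : FinPath S Act → PMF Act
  enabled : ∀ π, ∀ a ∈ (choice π).support, M.Enabled π.last a

namespace Scheduler

variable {M : MDP S Act} {N : MDP S' Act'}

/-- The choice depends on the last state only. -/
def Memoryless (σ : M.Scheduler) : Prop :=
  ∀ π π' : FinPath S Act, π.last = π'.last → σ.choice π = σ.choice π'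

/-- Every choice is a Dirac distribution. -/
def Deterministic (σ : M.Scheduler) : Prop :=
  ∀ π : FinPath S Act, ∃ a, σ.choice π = PMF.pure a

/-- The product scheduler on the product MDP, which resolves the two components independently. -/
noncomputable def prod (σ : M.Scheduler) (τ : N.Scheduler) : (M.prod N).Scheduler where
  choice π := PMF.ofFintype (fun p => σ.choice π.fst p.1 * τ.choice π.snd p.2) (by
    rw [Fintype.sum_prod_type, ← Finset.sum_mul_sum,
      ← tsum_fintype (L := .unconditional _), ← tsum_fintype (L := .unconditional _),
      PMF.tsum_coe, PMF.tsum_coe, one_mul])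
  enabled π a ha := by
    rw [PMF.mem_support_iff, PMF.ofFintype_apply] at ha
    have h1 := σ.enabled π.fst a.1 ((PMF.mem_support_iff _ _).2 (left_ne_zero_of_mul ha))
    have h2 := τ.enabled π.snd a.2 ((PMF.mem_support_iff _ _).2 (right_ne_zero_of_mul ha))
    rw [FinPath.last_fst] at h1
    rw [FinPath.last_snd] at h2
    unfold Enabled at h1 h2 ⊢
    change ∑ t : S × S', M.P π.last.1 a.1 t.1 * N.P π.last.2 a.2 t.2 = 1
    rw [sum_mul_prod, h1, h2, one_mul]

/-- The distribution of the next step `(α, t)` after the finite path `π`: it has probability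
`σ(π)(α) * P(last π, α, t)`. -/
noncomputable def step (σ : M.Scheduler) (π : FinPath S Act) : PMF (Act × S) :=
  PMF.ofFintype (fun p => σ.choice π p.1 * ENNReal.ofReal (M.P π.last p.1 p.2)) (by
    have h : ∀ a, ∑ t, σ.choice π a * ENNReal.ofReal (M.P π.last a t) = σ.choice π a := by
      intro a
      by_cases ha : σ.choice π a = 0
      · simp [ha]
      · have he := σ.enabled π a ((PMF.mem_support_iff _ _).2 ha)
        unfold Enabled at he
        rw [← Finset.mul_sum, ← ENNReal.ofReal_sum_of_nonneg
          (fun t _ => by exact_mod_cast M.P_nonneg _ _ _), ← Rat.cast_sum, he]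
        simp
    rw [Fintype.sum_prod_type]
    simp only [h]
    rw [← tsum_fintype (L := .unconditional _), PMF.tsum_coe])

variable [MeasurableSpace S] [MeasurableSingletonClass S]
  [MeasurableSpace Act] [MeasurableSingletonClass Act]

/-- The distribution of the step number `n + 1`, given the steps number `0, …, n` of a
sequence starting in `s`. -/
noncomputable def stepKernel (σ : M.Scheduler) (s : S) (n : ℕ) :
    Kernel ((_ : Finset.Iic n) → Act × S) (Act × S) :=
  Kernel.ofFunOfCountable fun x =>
    (σ.step ⟨s, List.ofFn fun i : Fin (n + 1) =>
      x ⟨i, Finset.mem_Iic.2 (Nat.lt_succ_iff.1 i.2)⟩⟩).toMeasure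

instance (σ : M.Scheduler) (s : S) (n : ℕ) : IsMarkovKernel (σ.stepKernel s n) :=
  ⟨fun _ => PMF.toMeasure.isProbabilityMeasure _⟩

/-- The measure on infinite paths starting in `s` induced by the scheduler `σ`. The cylinder of a
finite path `s₀ α₀ … s_k` with `s₀ = s` has measure
`∏ i < k, σ(s₀ α₀ … s_i)(α_i) * P(s_i, α_i, s_{i+1})`. -/
noncomputable def pathMeasure (σ : M.Scheduler) (s : S) : Measure (InfPath S Act) :=
  (Kernel.trajMeasure (X := fun _ => Act × S) (σ.step ⟨s, []⟩).toMeasure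
    (σ.stepKernel s)).map fun ω => (s, ω)

end Scheduler

variable [MeasurableSpace S] [MeasurableSingletonClass S]
  [MeasurableSpace Act] [MeasurableSingletonClass Act]

instance Scheduler.isProbabilityMeasure_pathMeasure {M : MDP S Act} (σ : M.Scheduler) (s : S) :
    IsProbabilityMeasure (σ.pathMeasure s) := by
  have : IsProbabilityMeasure (σ.step ⟨s, []⟩).toMeasure := PMF.toMeasure.isProbabilityMeasure _
  exact Measure.isProbabilityMeasure_map (by fun_prop)

/-- `V^{σ,τ}(X)`: half the expected squared deviation of `X` in two independent executions,
one under `σ` and one under `τ`, formed in the product of `M` with itself. -/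
noncomputable def pairVariance (M : MDP S Act) (X : InfPath S Act → ℝ) (σ τ : M.Scheduler) : ℝ :=
  1 / 2 * ∫ π, (X π.fst - X π.snd) ^ 2 ∂(σ.prod τ).pathMeasure (M.prod M).init

/-- The demonic variance of `X`: the supremum over all pairs of schedulers. -/
noncomputable def demonicVariance (M : MDP S Act) (X : InfPath S Act → ℝ) : EReal :=
  ⨆ (σ : M.Scheduler) (τ : M.Scheduler), ((M.pairVariance X σ τ : ℝ) : EReal)

end MDP

open Classical in
/-- Weighted reachability: the weight of the (first) state of `T` that is visited, and `0` if `T`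
is not visited. -/
noncomputable def weightedReach {S Act : Type*} (T : Set S) (wgt : T → ℚ)
    (π : InfPath S Act) : ℝ :=
  if h : ∃ n, InfPath.state π n ∈ T then
    (wgt ⟨InfPath.state π (Nat.find h), Nat.find_spec h⟩ : ℝ)
  else 0

/-- Weighted reachability is a random variable on infinite paths. -/
lemma measurable_weightedReach {S Act : Type*} [Fintype S]
    [MeasurableSpace S] [MeasurableSingletonClass S] [MeasurableSpace Act]
    (T : Set S) (wgt : T → ℚ) :
    Measurable (weightedReach (Act := Act) T wgt) := by
  classical
  let f : S → ℝ := fun s => if hs : s ∈ T then (wgt ⟨s, hs⟩ : ℝ) else 0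
  have hst (n : ℕ) : Measurable fun π : InfPath S Act => InfPath.state π n := by
    cases n with
    | zero => exact measurable_fst
    | succ n => simp only [InfPath.state]; fun_prop
  have hT (n : ℕ) : MeasurableSet {π : InfPath S Act | InfPath.state π n ∈ T} :=
    hst n T.toFinite.measurableSet
  have hN : MeasurableSet {π : InfPath S Act | ∀ m, InfPath.state π m ∉ T} := by
    rw [Set.ofPred_forall]
    exact MeasurableSet.iInter fun m => (hT m).compl
  have hex (π : InfPath S Act) :
      ∃ n, InfPath.state π n ∈ T ∨ ∀ m, InfPath.state π m ∉ T := by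
    by_cases h : ∃ n, InfPath.state π n ∈ T
    · exact ⟨h.choose, Or.inl h.choose_spec⟩
    · exact ⟨0, Or.inr (not_exists.1 h)⟩
  have hm := Measurable.find (f := fun n (π : InfPath S Act) => f (InfPath.state π n))
    (p := fun n (π : InfPath S Act) => InfPath.state π n ∈ T ∨ ∀ m, InfPath.state π m ∉ T)
    (fun n => (measurable_of_finite f).comp (hst n))
    (fun n => (hT n).union hN) hex
  convert hm using 2 with π
  unfold weightedReach
  split_ifs with h
  · have hfind : Nat.find (hex π) = Nat.find h := by
      apply Nat.find_congr'
      intro n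
      exact or_iff_left fun h' => h' _ h.choose_spec
    have hs := Nat.find_spec h
    rw [hfind]
    simp only [f, dif_pos hs]
  · simp only [f]
    rw [dif_neg (not_exists.1 h _)]

/-- The expectation that defines the pair variance of weighted reachability exists. -/
lemma integrable_weightedReach_sub_sq {S Act : Type*} [Fintype S] [Fintype Act]
    [MeasurableSpace S] [MeasurableSingletonClass S]
    [MeasurableSpace Act] [MeasurableSingletonClass Act]
    (M : MDP S Act) (T : Set S) (wgt : T → ℚ) (σ τ : M.Scheduler) :
    Integrable (fun π => (weightedReach T wgt (InfPath.fst π) -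
      weightedReach T wgt (InfPath.snd π)) ^ 2) ((σ.prod τ).pathMeasure (M.prod M).init) := by
  classical
  have hfst : Measurable (InfPath.fst : InfPath (S × S) (Act × Act) → InfPath S Act) := by
    unfold InfPath.fst; fun_prop
  have hsnd : Measurable (InfPath.snd : InfPath (S × S) (Act × Act) → InfPath S Act) := by
    unfold InfPath.snd; fun_prop
  have hW := measurable_weightedReach (Act := Act) T wgt
  have hb (π : InfPath S Act) : |weightedReach T wgt π| ≤ ∑ t : T, |(wgt t : ℝ)| := by
    unfold weightedReach
    split_ifs with h
    · exact Finset.single_le_sum (f := fun t : T => |(wgt t : ℝ)|)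
        (fun _ _ => abs_nonneg _) (Finset.mem_univ _)
    · simpa using Finset.sum_nonneg fun (t : T) _ => abs_nonneg (wgt t : ℝ)
  have := σ.prod τ |>.isProbabilityMeasure_pathMeasure (M.prod M).init
  refine Integrable.of_bound
    (((hW.comp hfst).sub (hW.comp hsnd)).pow_const 2).aestronglyMeasurable
    ((∑ t : T, |(wgt t : ℝ)| + ∑ t : T, |(wgt t : ℝ)|) ^ 2) (ae_of_all _ fun π => ?_)
  rw [Real.norm_eq_abs, abs_of_nonneg (sq_nonneg _), sq_le_sq]
  refine ((abs_sub _ _).trans (add_le_add (hb _) (hb _))).trans (le_abs_self _)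

/-! The components of the product are independent (`pathMeasure_prod_map`), so with X = WR the pair
variance is ½(E_σ X² − 2 E_σ X · E_τ X + E_τ X²). Fix τ and put c = E_τ X. Then σ enters only
through E_σ(X² − 2cX), and X² − 2cX is again a weighted reachability, with terminal reward f² − 2cf.
Hence optimizing one scheduler against a fixed other one is an expected-reward problem. Replacing
first σ and then, by symmetry, τ by memoryless deterministic schedulers does not decrease the
variance; only finitely many such pairs exist, so the supremum is a maximum.

For expected terminal rewards (`exists_policy_ge`), discount each step by γ < 1. The Bellman
operator is then a contraction; its fixed point bounds the reward of every scheduler and is attained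
by a greedy policy. As γ tends to 1, one of the finitely many policies is optimal for infinitely
many discount factors, and dominated convergence transfers its optimality to γ = 1. -/

/-! ### Measures on sequences are determined by initial segments -/

theorem measurableSet_initialSegment {X : Type*} [MeasurableSpace X] [MeasurableSingletonClass X]
    (n : ℕ) (x : ℕ → X) : MeasurableSet {ω : ℕ → X | ∀ i < n, ω i = x i} := by
  simp only [Set.ofPred_forall]
  exact .iInter fun i => .iInter fun _ =>
    (measurableSet_singleton (x i)).preimage (measurable_pi_apply i)

theorem MeasureTheory.Measure.ext_of_initialSegments {X : Type*} [Countable X]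
    [MeasurableSpace X] [MeasurableSingletonClass X] {μ ν : Measure (ℕ → X)}
    [IsFiniteMeasure μ]
    (h : ∀ (n : ℕ) (x : ℕ → X), μ {ω | ∀ i < n, ω i = x i} = ν {ω | ∀ i < n, ω i = x i}) :
    μ = ν := by
  rcases isEmpty_or_nonempty X with hX | ⟨⟨x₀⟩⟩
  · exact Measure.eq_zero_of_isEmpty μ |>.trans (Measure.eq_zero_of_isEmpty ν).symm
  -- μ is the projective limit of its own marginals, so it suffices to compare ν with those over
  -- `Iic n`, point by point.
  have hμ : IsProjectiveLimit μ fun I : Finset ℕ => μ.map I.restrict := fun _ => rfl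
  refine hμ.unique ((isProjectiveLimit_nat_iff (isProjectiveMeasureFamily_map_restrict fun i ↦ (measurable_pi_apply i).aemeasurable) ν).2 fun n => ?_)
  refine Measure.ext_of_singleton fun y => ?_
  rw [Measure.map_apply (by fun_prop) (measurableSet_singleton _),
    Measure.map_apply (by fun_prop) (measurableSet_singleton _)]
  have hset : (Preorder.frestrictLe n : (ℕ → X) → _) ⁻¹' {y} =
      {ω | ∀ i < n + 1, ω i = (fun j => if hj : j ∈ Finset.Iic n then y ⟨j, hj⟩ else x₀) i} := by
    ext ω
    simp only [Set.mem_preimage, Set.mem_singleton_iff, Set.mem_ofPred_eq, funext_iff,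
      Subtype.forall, Finset.mem_Iic, Nat.lt_succ_iff]
    refine forall₂_congr fun i hi => ?_
    simp [hi]
  rw [hset, ← h, ← hset]
  rfl

/-! ### Path measures and independence of the components -/

namespace MDP.Scheduler

variable {S Act S' Act' : Type*} [Fintype S] [Fintype Act] [Fintype S'] [Fintype Act']
  {M : MDP S Act} {N : MDP S' Act'}

theorem step_prod (σ : M.Scheduler) (τ : N.Scheduler) (π : FinPath (S × S') (Act × Act'))
    (p : (Act × Act') × (S × S')) :
    (σ.prod τ).step π p = σ.step π.fst (p.1.1, p.2.1) * τ.step π.snd (p.1.2, p.2.2) := by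
  simp only [step, prod, MDP.prod, PMF.ofFintype_apply, FinPath.last_fst, FinPath.last_snd]
  rw [Rat.cast_mul, ENNReal.ofReal_mul (by exact_mod_cast M.P_nonneg _ _ _)]
  ring

variable  [MeasurableSpace S] [MeasurableSingletonClass S]
  [MeasurableSpace Act] [MeasurableSingletonClass Act]
  [MeasurableSpace S'] [MeasurableSingletonClass S']
  [MeasurableSpace Act'] [MeasurableSingletonClass Act']

/-- The law of the sequence of steps of a path starting in `s` under the scheduler `σ`. -/
noncomputable def stepsMeasure (σ : M.Scheduler) (s : S) : Measure (ℕ → Act × S) :=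
  Kernel.trajMeasure (X := fun _ => Act × S) (σ.step ⟨s, []⟩).toMeasure (σ.stepKernel s)

instance (σ : M.Scheduler) (s : S) : IsProbabilityMeasure (σ.stepsMeasure s) := by
  have : IsProbabilityMeasure (σ.step ⟨s, []⟩).toMeasure := PMF.toMeasure.isProbabilityMeasure _
  unfold stepsMeasure
  infer_instance

theorem pathMeasure_eq_map_stepsMeasure (σ : M.Scheduler) (s : S) :
    σ.pathMeasure s = (σ.stepsMeasure s).map fun ω => (s, ω) := rfl

theorem map_eval_zero_stepsMeasure (σ : M.Scheduler) (s : S) :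
    (σ.stepsMeasure s).map (fun ω => ω 0) = (σ.step ⟨s, []⟩).toMeasure := by
  have h : (fun ω : ℕ → Act × S => ω 0) =
      (MeasurableEquiv.piUnique fun _ : Finset.Iic 0 => Act × S) ∘ Preorder.frestrictLe 0 := rfl
  unfold stepsMeasure Kernel.trajMeasure
  rw [h, ← Measure.map_map (by fun_prop) (by fun_prop), Measure.map_comp _ _ (by fun_prop),
    Kernel.traj_map_frestrictLe, Kernel.partialTraj_self, Measure.id_comp]
  exact MeasurableEquiv.map_map_symm _

/-- One-step conditioning: the `n`-th step is distributed according to `step` given the previous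
ones. -/
theorem integral_stepsMeasure_step (σ : M.Scheduler) (s : S) (n : ℕ)
    (F : List (Act × S) → Act × S → ℝ) :
    ∫ ω, F (List.ofFn fun i : Fin n => ω i) (ω n) ∂σ.stepsMeasure s =
      ∫ ω, ∑ p, (σ.step ⟨s, List.ofFn fun i : Fin n => ω i⟩ p).toReal *
        F (List.ofFn fun i : Fin n => ω i) p ∂σ.stepsMeasure s := by
  have hpmf (q : PMF (Act × S)) (f : Act × S → ℝ) :
      ∫ p, f p ∂q.toMeasure = ∑ p, (q p).toReal * f p := by
    simp [PMF.integral_eq_sum]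
  cases n with
  | zero =>
    -- Step 0 comes from the initial law; `stepKernel σ s n` only governs step n + 1, hence the case
    -- split.
    simp only [List.ofFn_zero, integral_const, probReal_univ, one_smul]
    rw [← hpmf, ← map_eval_zero_stepsMeasure, integral_map (measurable_pi_apply 0).aemeasurable
      (measurable_of_countable _).aestronglyMeasurable]
  | succ n =>
    have : IsProbabilityMeasure (σ.step ⟨s, []⟩).toMeasure :=
      PMF.toMeasure.isProbabilityMeasure _
    let l : ((_ : Finset.Iic n) → Act × S) → List (Act × S) := fun x =>
      List.ofFn fun i : Fin (n + 1) => x ⟨i, Finset.mem_Iic.2 (Nat.lt_succ_iff.1 i.2)⟩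
    have key := Kernel.map_frestrictLe_trajMeasure_compProd_eq_map_trajMeasure
      (X := fun _ => Act × S) (μ₀ := (σ.step ⟨s, []⟩).toMeasure) (κ := σ.stepKernel s) (a := n)
    change (σ.stepsMeasure s).map _ ⊗ₘ _ = (σ.stepsMeasure s).map _ at key
    have hF : Measurable fun z : ((_ : Finset.Iic n) → Act × S) × (Act × S) => F (l z.1) z.2 :=
      measurable_of_countable _
    have h1 := integral_map (μ := σ.stepsMeasure s)
      (φ := fun ω => (Preorder.frestrictLe n ω, ω (n + 1))) (by fun_prop)
      hF.aestronglyMeasurable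
    rw [← key, Measure.integral_compProd] at h1
    · rw [integral_map (by fun_prop) (measurable_of_countable _).aestronglyMeasurable] at h1
      refine Eq.trans h1.symm (integral_congr_ae (ae_of_all _ fun ω => ?_))
      exact hpmf _ _
    · have : IsFiniteMeasure ((σ.stepsMeasure s).map (Preorder.frestrictLe n)) := inferInstance
      exact Integrable.of_finite

/-- Cylinder probabilities factor into the probabilities of the steps. -/
theorem stepsMeasure_real_succ (σ : M.Scheduler) (s : S) (n : ℕ) (x : ℕ → Act × S) :
    (σ.stepsMeasure s).real {ω | ∀ i < n + 1, ω i = x i} =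
      (σ.step ⟨s, List.ofFn fun i : Fin n => x i⟩ (x n)).toReal *
        (σ.stepsMeasure s).real {ω | ∀ i < n, ω i = x i} := by
  classical
  have hl (n : ℕ) (ω : ℕ → Act × S) :
      (List.ofFn (fun i : Fin n => ω i) = List.ofFn fun i : Fin n => x i) ↔
        ∀ i < n, ω i = x i := by
    rw [List.ofFn_inj, funext_iff, Fin.forall_iff]
  -- The test function is the indicator of one prefix followed by one step.
  have h := integral_stepsMeasure_step σ s n fun l p =>
    if l = List.ofFn (fun i : Fin n => x i) then if p = x n then 1 else 0 else 0
  rw [← integral_indicator_one (measurableSet_initialSegment _ _), ← integral_indicator_one (measurableSet_initialSegment _ _), ← integral_const_mul]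
  refine Eq.trans ?_ (h.trans ?_)
  · refine integral_congr_ae (ae_of_all _ fun ω => ?_)
    simp only [Set.indicator_apply, Set.mem_ofPred_eq, Nat.forall_lt_succ_right, hl, Pi.one_apply]
    split_ifs <;> tauto
  · refine integral_congr_ae (ae_of_all _ fun ω => ?_)
    simp only [Set.indicator_apply, Set.mem_ofPred_eq, hl, Pi.one_apply]
    split_ifs with hω
    · simp [(hl n ω).2 hω]
    · simp

theorem stepsMeasure_prod_real (σ : M.Scheduler) (τ : N.Scheduler) (s : S × S') (n : ℕ)
    (x : ℕ → (Act × Act') × (S × S')) :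
    ((σ.prod τ).stepsMeasure s).real {ω | ∀ i < n, ω i = x i} =
      (σ.stepsMeasure s.1).real {ω | ∀ i < n, ω i = ((x i).1.1, (x i).2.1)} *
        (τ.stepsMeasure s.2).real {ω | ∀ i < n, ω i = ((x i).1.2, (x i).2.2)} := by
  induction n with
  | zero => simp
  | succ n ih =>
    rw [stepsMeasure_real_succ, stepsMeasure_real_succ, stepsMeasure_real_succ, ih, step_prod,
      ENNReal.toReal_mul]
    simp only [FinPath.fst, FinPath.snd, List.map_ofFn, Function.comp_def]
    ring

/-- Under the product scheduler, the two components are independent. -/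
theorem stepsMeasure_prod (σ : M.Scheduler) (τ : N.Scheduler) (s : S × S') :
    (σ.prod τ).stepsMeasure s = ((σ.stepsMeasure s.1).prod (τ.stepsMeasure s.2)).map
      fun z i => (((z.1 i).1, (z.2 i).1), ((z.1 i).2, (z.2 i).2)) := by
  refine Measure.ext_of_initialSegments fun n x => ?_
  have hpre : (fun (z : (ℕ → Act × S) × (ℕ → Act' × S')) (i : ℕ) =>
        (((z.1 i).1, (z.2 i).1), ((z.1 i).2, (z.2 i).2))) ⁻¹' {ω | ∀ i < n, ω i = x i} =
      {ω | ∀ i < n, ω i = ((x i).1.1, (x i).2.1)} ×ˢ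
        {ω | ∀ i < n, ω i = ((x i).1.2, (x i).2.2)} := by
    ext z
    simp only [Set.mem_preimage, Set.mem_ofPred_eq, Set.mem_prod, Prod.ext_iff, ← forall_and]
    refine forall₂_congr fun i _ => ?_
    tauto
  rw [Measure.map_apply (by fun_prop)
    (measurableSet_initialSegment n x), hpre, Measure.prod_prod,
    ← ENNReal.toReal_eq_toReal_iff' (by finiteness) (by finiteness), ENNReal.toReal_mul]
  exact stepsMeasure_prod_real σ τ s n x

/-- Independence in the form needed for expectations: integrals over the product MDP become
integrals over a product measure. -/
theorem pathMeasure_prod_map (σ : M.Scheduler) (τ : N.Scheduler) (s : S × S') :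
    ((σ.prod τ).pathMeasure s).map (fun π => (InfPath.fst π, InfPath.snd π)) =
      (σ.pathMeasure s.1).prod (τ.pathMeasure s.2) := by
  have hfst : Measurable (InfPath.fst : InfPath (S × S') (Act × Act') → InfPath S Act) := by
    unfold InfPath.fst; fun_prop
  have hsnd : Measurable (InfPath.snd : InfPath (S × S') (Act × Act') → InfPath S' Act') := by
    unfold InfPath.snd; fun_prop
  simp only [pathMeasure_eq_map_stepsMeasure]
  rw [stepsMeasure_prod, Measure.map_map (by fun_prop) (by fun_prop),
    Measure.map_map (by fun_prop) (by fun_prop),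
    Measure.map_prod_map _ _ (by fun_prop) (by fun_prop)]
  rfl

end MDP.Scheduler

/-! ### Discounted and stopped rewards along a path -/

open Filter Topology

namespace InfPath

variable {S Act : Type*}

open Classical in
/-- Reachability of `T` with terminal reward `f`, discounted by `γ` in each step. -/
noncomputable def discountedReach (γ : ℝ) (T : Set S) (f : S → ℝ) (π : InfPath S Act) : ℝ :=
  if h : ∃ n, state π n ∈ T then γ ^ Nat.find h * f (state π (Nat.find h)) else 0

open Classical in
/-- The process `γ ^ n * v (s_n)`, stopped when `T` is reached. -/
noncomputable def stoppedReward (γ : ℝ) (T : Set S) (v : S → ℝ) (π : InfPath S Act) : ℕ → ℝ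
  | 0 => v (state π 0)
  | n + 1 => stoppedReward γ T v π n +
      if ∀ k ≤ n, state π k ∉ T then γ ^ n * (γ * v (state π (n + 1)) - v (state π n)) else 0

variable {γ : ℝ} {T : Set S} {f g v : S → ℝ} {π : InfPath S Act} {n N : ℕ}

theorem stoppedReward_of_forall_notMem (h : ∀ k < n, state π k ∉ T) :
    stoppedReward γ T v π n = γ ^ n * v (state π n) := by
  induction n with
  | zero => simp [stoppedReward]
  | succ n ih =>
    rw [stoppedReward, ih fun k hk => h k (by omega), if_pos fun k hk => h k (by omega)]
    ring

theorem stoppedReward_of_mem (h : ∀ k < N, state π k ∉ T) (hN : state π N ∈ T) (hn : N ≤ n) :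
    stoppedReward γ T v π n = γ ^ N * v (state π N) := by
  induction n, hn using Nat.le_induction with
  | base => exact stoppedReward_of_forall_notMem h
  | succ n hn ih => rw [stoppedReward, ih, if_neg fun h' => h' N hn hN, add_zero]

theorem discountedReach_of_mem (h : ∀ k < N, state π k ∉ T) (hN : state π N ∈ T) :
    discountedReach γ T f π = γ ^ N * f (state π N) := by
  classical
  have hex : ∃ n, state π n ∈ T := ⟨N, hN⟩
  have : Nat.find hex = N := (Nat.find_eq_iff hex).2 ⟨hN, h⟩
  rw [discountedReach, dif_pos hex, this]

theorem discountedReach_of_forall_notMem (h : ∀ k, state π k ∉ T) :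
    discountedReach γ T f π = 0 := dif_neg (not_exists.2 h)

/-- Either `T` is never reached or there is a first time at which it is. -/
theorem forall_notMem_or_exists_first (T : Set S) (π : InfPath S Act) :
    (∀ k, state π k ∉ T) ∨ ∃ N, (∀ k < N, state π k ∉ T) ∧ state π N ∈ T := by
  classical
  by_cases h : ∃ n, state π n ∈ T
  · exact .inr ⟨Nat.find h, fun k => Nat.find_min h, Nat.find_spec h⟩
  · exact .inl (not_exists.1 h)

/-- Only rewards on `T` are ever collected; this allows the value function to stand in for the
terminal reward. -/
theorem discountedReach_congr (h : Set.EqOn f g T) :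
    discountedReach γ T f π = discountedReach γ T g π := by
  rcases forall_notMem_or_exists_first T π with hπ | ⟨N, hπ, hN⟩
  · rw [discountedReach_of_forall_notMem hπ, discountedReach_of_forall_notMem hπ]
  · rw [discountedReach_of_mem hπ hN, discountedReach_of_mem hπ hN, h hN]

theorem discountedReach_neg : discountedReach γ T (-f) π = -discountedReach γ T f π := by
  rcases forall_notMem_or_exists_first T π with hπ | ⟨N, hπ, hN⟩
  · simp [discountedReach_of_forall_notMem hπ]
  · simp [discountedReach_of_mem hπ hN]

theorem abs_pow_mul_le_sum [Fintype S] (h0 : 0 ≤ γ) (h1 : γ ≤ 1) (v : S → ℝ) (n : ℕ) (s : S) :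
    |γ ^ n * v s| ≤ ∑ s, |v s| := by
  rw [abs_mul, abs_of_nonneg (pow_nonneg h0 n)]
  exact (mul_le_of_le_one_left (abs_nonneg _) (pow_le_one₀ h0 h1)).trans
    (Finset.single_le_sum (f := fun s => |v s|) (fun _ _ => abs_nonneg _) (Finset.mem_univ s))

theorem abs_discountedReach_le [Fintype S] (h0 : 0 ≤ γ) (h1 : γ ≤ 1) (f : S → ℝ)
    (π : InfPath S Act) : |discountedReach γ T f π| ≤ ∑ s, |f s| := by
  rcases forall_notMem_or_exists_first T π with hπ | ⟨N, hπ, hN⟩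
  · rw [discountedReach_of_forall_notMem hπ, abs_zero]
    exact Finset.sum_nonneg fun _ _ => abs_nonneg _
  · rw [discountedReach_of_mem hπ hN]
    exact abs_pow_mul_le_sum h0 h1 f N _

theorem abs_stoppedReward_le [Fintype S] (h0 : 0 ≤ γ) (h1 : γ ≤ 1) (v : S → ℝ)
    (π : InfPath S Act) (n : ℕ) : |stoppedReward γ T v π n| ≤ ∑ s, |v s| := by
  rcases forall_notMem_or_exists_first T π with hπ | ⟨N, hπ, hN⟩
  · rw [stoppedReward_of_forall_notMem fun k _ => hπ k]
    exact abs_pow_mul_le_sum h0 h1 v n _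
  · rcases le_total N n with hn | hn
    · rw [stoppedReward_of_mem hπ hN hn]
      exact abs_pow_mul_le_sum h0 h1 v N _
    · rw [stoppedReward_of_forall_notMem fun k hk => hπ k (hk.trans_le hn)]
      exact abs_pow_mul_le_sum h0 h1 v n _

/-- On a path avoiding `T`, discounting forces γ^n v(s_n) to 0, the reward of such a path; for γ = 1
this can fail. On a path that hits `T` the process is eventually constant. -/
theorem tendsto_stoppedReward [Finite S] (h0 : 0 ≤ γ) (h1 : γ < 1) (v : S → ℝ)
    (π : InfPath S Act) :
    Tendsto (stoppedReward γ T v π) atTop (𝓝 (discountedReach γ T v π)) := by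
  have := Fintype.ofFinite S
  rcases forall_notMem_or_exists_first T π with hπ | ⟨N, hπ, hN⟩
  · rw [discountedReach_of_forall_notMem hπ]
    refine squeeze_zero_norm (a := fun n => γ ^ n * ∑ s, |v s|) (fun n => ?_) ?_
    · rw [stoppedReward_of_forall_notMem fun k _ => hπ k, Real.norm_eq_abs, abs_mul,
        abs_of_nonneg (pow_nonneg h0 n)]
      exact mul_le_mul_of_nonneg_left (Finset.single_le_sum (f := fun s => |v s|)
        (fun _ _ => abs_nonneg _) (Finset.mem_univ _)) (pow_nonneg h0 n)
    · simpa using (tendsto_pow_atTop_nhds_zero_of_lt_one h0 h1).mul_const (∑ s, |v s|)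
  · rw [discountedReach_of_mem hπ hN]
    exact tendsto_const_nhds.congr' ((eventually_ge_atTop N).mono fun n hn =>
      (stoppedReward_of_mem hπ hN hn).symm)

/-- For a fixed path the hitting time N is fixed, so only continuity of the N-th power is involved.
-/
theorem tendsto_discountedReach_one {u : ℕ → ℝ} (hu : Tendsto u atTop (𝓝 1)) (f : S → ℝ)
    (π : InfPath S Act) :
    Tendsto (fun n => discountedReach (u n) T f π) atTop (𝓝 (discountedReach 1 T f π)) := by
  rcases forall_notMem_or_exists_first T π with hπ | ⟨N, hπ, hN⟩
  · simp only [discountedReach_of_forall_notMem hπ, tendsto_const_nhds]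
  · simp only [discountedReach_of_mem hπ hN]
    exact (hu.pow N).mul_const _

/-- The sequence of discount factors `1 - 1 / (n + 1)`. -/
theorem tendsto_one_sub_inv : Tendsto (fun n : ℕ => 1 - 1 / ((n : ℝ) + 1)) atTop (𝓝 1) := by
  simpa using tendsto_one_div_add_atTop_nhds_zero_nat.const_sub (1 : ℝ)

theorem one_sub_inv_nonneg (n : ℕ) : 0 ≤ 1 - 1 / ((n : ℝ) + 1) := by
  rw [sub_nonneg, div_le_one (by positivity)]
  linarith [n.cast_nonneg (α := ℝ)]

theorem one_sub_inv_lt_one (n : ℕ) : 1 - 1 / ((n : ℝ) + 1) < 1 :=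
  sub_lt_self _ (by positivity)

theorem measurable_state [MeasurableSpace S] [MeasurableSpace Act] (n : ℕ) : Measurable fun π : InfPath S Act => state π n := by
  cases n with
  | zero => exact measurable_fst
  | succ n => simp only [InfPath.state]; fun_prop

section Measurability

variable [Finite S] [MeasurableSpace S] [MeasurableSingletonClass S] [MeasurableSpace Act]

theorem measurable_stoppedReward (γ : ℝ) (T : Set S) (v : S → ℝ) (n : ℕ) :
    Measurable fun π : InfPath S Act => stoppedReward γ T v π n := by
  have hv (n : ℕ) : Measurable fun π : InfPath S Act => v (state π n) :=
    (measurable_of_finite v).comp (measurable_state n)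
  induction n with
  | zero => exact hv 0
  | succ n ih =>
    refine ih.add (Measurable.ite ?_ ((((hv _).const_mul γ).sub (hv n)).const_mul _)
      measurable_const)
    simp only [Set.ofPred_forall]
    exact .iInter fun k => .iInter fun _ =>
      (T.toFinite.measurableSet.preimage (measurable_state k)).compl

theorem measurable_discountedReach {γ : ℝ} (h0 : 0 ≤ γ) (h1 : γ ≤ 1) (T : Set S) (f : S → ℝ) :
    Measurable (discountedReach (Act := Act) γ T f) := by
  have hlt {γ : ℝ} (h0 : 0 ≤ γ) (h1 : γ < 1) :
      Measurable (discountedReach (Act := Act) γ T f) :=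
    measurable_of_tendsto_metrizable (fun n => measurable_stoppedReward γ T f n)
      (tendsto_pi_nhds.2 fun π => tendsto_stoppedReward h0 h1 f π)
  rcases h1.lt_or_eq with h1 | rfl
  · exact hlt h0 h1
  · exact measurable_of_tendsto_metrizable
      (fun n => hlt (one_sub_inv_nonneg n) (one_sub_inv_lt_one n))
      (tendsto_pi_nhds.2 fun π => tendsto_discountedReach_one tendsto_one_sub_inv f π)

end Measurability

/-- The prefix with `n` steps ends in the state `s_n`. -/
theorem last_prefix (s : S) (ω : ℕ → Act × S) (n : ℕ) :
    FinPath.last ⟨s, List.ofFn fun i : Fin n => ω i⟩ = state (s, ω) n := by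
  cases n with
  | zero => rfl
  | succ n =>
    simp only [FinPath.last, List.ofFn_succ', List.concat_eq_append, List.getLast?_append]
    simp [state]

/-- Avoiding `T` up to time n is decided by the first n steps, so one-step conditioning applies to
the increments of the stopped process. -/
theorem forall_notMem_prefix (s : S) (ω : ℕ → Act × S) (n : ℕ) :
    (s ∉ T ∧ ∀ p ∈ List.ofFn fun i : Fin n => ω i, p.2 ∉ T) ↔ ∀ k ≤ n, state (s, ω) k ∉ T := by
  simp only [List.forall_mem_ofFn_iff, Fin.forall_iff]
  constructor
  · rintro ⟨h0, h⟩ (_ | k) hk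
    · exact h0
    · exact h k hk
  · exact fun h => ⟨h 0 n.zero_le, fun k hk => h (k + 1) hk⟩

end InfPath

/-! ### Optimality equation and memoryless deterministic schedulers -/

namespace MDP

open InfPath

variable {S Act : Type*} [Fintype S] [Fintype Act] {M : MDP S Act}

theorem P_real_nonneg (M : MDP S Act) (s : S) (a : Act) (t : S) : (0 : ℝ) ≤ M.P s a t := by
  exact_mod_cast M.P_nonneg s a t

theorem Enabled.sum_real {s : S} {a : Act} (h : M.Enabled s a) : ∑ t, (M.P s a t : ℝ) = 1 := by
  exact_mod_cast h

/-- The optimality equation of discounted reachability has a solution, and the maxima are attained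
by enabled actions. -/
theorem exists_discounted_optimality_equation (M : MDP S Act) (T : Set S) (f : S → ℝ) {γ : ℝ}
    (h0 : 0 ≤ γ) (h1 : γ < 1) :
    ∃ v : S → ℝ, Set.EqOn v f T ∧
      (∀ s ∉ T, ∀ a, M.Enabled s a → γ * ∑ t, M.P s a t * v t ≤ v s) ∧
      ∃ d : ∀ s, {a // M.Enabled s a}, ∀ s ∉ T, v s = γ * ∑ t, M.P s (d s) t * v t := by
  classical
  let A (s : S) : Finset Act := Finset.univ.filter (M.Enabled s)
  have hA (s : S) : (A s).Nonempty := by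
    obtain ⟨a, ha⟩ := M.exists_enabled s
    exact ⟨a, Finset.mem_filter.2 ⟨Finset.mem_univ _, ha⟩⟩
  let q (v : S → ℝ) (s : S) (a : Act) : ℝ := γ * ∑ t, M.P s a t * v t
  -- The Bellman operator. It is γ-Lipschitz for the sup metric because enabled rows sum to one, so
  -- Banach's theorem yields v.
  let B (v : S → ℝ) (s : S) : ℝ := if s ∈ T then f s else (A s).sup' (hA s) (q v s)
  have hq (v w : S → ℝ) (s : S) (a : Act) (ha : a ∈ A s) : q v s a ≤ q w s a + γ * dist v w := by
    have hsum : ∑ t, M.P s a t * v t ≤ ∑ t, M.P s a t * w t + dist v w := by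
      calc ∑ t, M.P s a t * v t ≤ ∑ t, M.P s a t * (w t + dist v w) :=
            Finset.sum_le_sum fun t _ => mul_le_mul_of_nonneg_left (by
              have := (le_abs_self _).trans_eq (Real.dist_eq (v t) (w t)).symm
              linarith [dist_le_pi_dist v w t]) (M.P_real_nonneg s a t)
        _ = _ := by
          simp only [mul_add, Finset.sum_add_distrib, ← Finset.sum_mul]
          rw [Enabled.sum_real (Finset.mem_filter.1 ha).2, one_mul]
    have := mul_le_mul_of_nonneg_left hsum h0
    simp only [q]
    linarith
  have hB (v w : S → ℝ) (s : S) : B v s ≤ B w s + γ * dist v w := by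
    simp only [B]
    split_ifs
    · exact le_add_of_nonneg_right (mul_nonneg h0 dist_nonneg)
    · exact Finset.sup'_le _ _ fun a ha => (hq v w s a ha).trans
        (add_le_add_left (Finset.le_sup' (q w s) ha) _)
  have hcontr : ContractingWith ⟨γ, h0⟩ B := by
    refine ⟨by exact_mod_cast h1, LipschitzWith.of_dist_le_mul fun v w => ?_⟩
    refine (dist_pi_le_iff (mul_nonneg h0 dist_nonneg)).2 fun s => ?_
    rw [Real.dist_eq, abs_sub_le_iff]
    have h2 := hB w v s
    rw [dist_comm] at h2
    exact ⟨sub_le_iff_le_add'.2 (hB v w s), sub_le_iff_le_add'.2 h2⟩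
  let v := ContractingWith.fixedPoint B hcontr
  have hv (s : S) : B v s = v s := congrFun hcontr.fixedPoint_isFixedPt s
  have hv' (s : S) (hs : s ∉ T) : (A s).sup' (hA s) (q v s) = v s := by
    rw [← hv s]; exact (if_neg hs).symm
  have hd (s : S) : ∃ a : {a // M.Enabled s a}, s ∉ T → v s = q v s a := by
    obtain ⟨a, ha, hmax⟩ := Finset.exists_mem_eq_sup' (hA s) (q v s)
    exact ⟨⟨a, (Finset.mem_filter.1 ha).2⟩, fun hs => (hv' s hs).symm.trans hmax⟩
  choose d hd using hd
  refine ⟨v, fun s hs => by rw [← hv s]; exact if_pos hs, fun s hs a ha => ?_, d, hd⟩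
  rw [← hv' s hs]
  exact Finset.le_sup' (q v s) (Finset.mem_filter.2 ⟨Finset.mem_univ _, ha⟩)

namespace Scheduler

/-- The memoryless deterministic scheduler given by a choice of an enabled action in each state. -/
noncomputable def ofPolicy (d : ∀ s, {a // M.Enabled s a}) : M.Scheduler where
  choice π := PMF.pure (d π.last)
  enabled π a ha := by
    rw [PMF.support_pure, Set.mem_singleton_iff] at ha
    exact ha ▸ (d π.last).2

theorem ofPolicy_memoryless (d : ∀ s, {a // M.Enabled s a}) : (ofPolicy d).Memoryless :=
  fun _ _ h => congrArg (fun s => PMF.pure (d s : Act)) h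

theorem ofPolicy_deterministic (d : ∀ s, {a // M.Enabled s a}) : (ofPolicy d).Deterministic :=
  fun π => ⟨d π.last, rfl⟩

theorem sum_toReal_pmf {α : Type*} [Fintype α] (p : PMF α) : ∑ a, (p a).toReal = 1 := by
  rw [← ENNReal.toReal_sum fun a _ => p.apply_ne_top a, ← tsum_fintype (L := .unconditional _),
    p.tsum_coe, ENNReal.toReal_one]

theorem sum_step_mul (σ : M.Scheduler) (π : FinPath S Act) (g : S → ℝ) :
    ∑ p, (σ.step π p).toReal * g p.2 =
      ∑ a, (σ.choice π a).toReal * ∑ t, M.P π.last a t * g t := by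
  rw [Fintype.sum_prod_type]
  refine Finset.sum_congr rfl fun a _ => ?_
  rw [Finset.mul_sum]
  refine Finset.sum_congr rfl fun t _ => ?_
  rw [step, PMF.ofFintype_apply, ENNReal.toReal_mul,
    ENNReal.toReal_ofReal (M.P_real_nonneg _ _ _), mul_assoc]

theorem sum_step_ofPolicy_mul (d : ∀ s, {a // M.Enabled s a}) (π : FinPath S Act) (g : S → ℝ) :
    ∑ p, ((ofPolicy d).step π p).toReal * g p.2 = ∑ t, M.P π.last (d π.last) t * g t := by
  classical
  rw [sum_step_mul, Finset.sum_eq_single (d π.last : Act)]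
  · simp [ofPolicy]
  · intro a _ ha
    simp [ofPolicy, PMF.pure_apply, ha]
  · simp

/-- A randomized choice averages over enabled actions, so a bound valid for each of them survives.
-/
theorem mul_sum_step_le (σ : M.Scheduler) (π : FinPath S Act) {γ c : ℝ} {v : S → ℝ}
    (h : ∀ a, M.Enabled π.last a → γ * ∑ t, M.P π.last a t * v t ≤ c) :
    γ * ∑ p, (σ.step π p).toReal * v p.2 ≤ c := by
  calc γ * ∑ p, (σ.step π p).toReal * v p.2
      = ∑ a, (σ.choice π a).toReal * (γ * ∑ t, M.P π.last a t * v t) := by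
        rw [sum_step_mul, Finset.mul_sum]
        exact Finset.sum_congr rfl fun _ _ => mul_left_comm _ _ _
    _ ≤ ∑ a, (σ.choice π a).toReal * c := Finset.sum_le_sum fun a _ => by
        by_cases ha : σ.choice π a = 0
        · simp [ha]
        · exact mul_le_mul_of_nonneg_left
            (h a (σ.enabled π a ((PMF.mem_support_iff _ _).2 ha))) ENNReal.toReal_nonneg
    _ = c := by rw [← Finset.sum_mul, sum_toReal_pmf, one_mul]

variable [MeasurableSpace S] [MeasurableSingletonClass S]
  [MeasurableSpace Act] [MeasurableSingletonClass Act]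

theorem integral_pathMeasure (σ : M.Scheduler) (s : S) {X : InfPath S Act → ℝ}
    (hX : Measurable X) : ∫ π, X π ∂σ.pathMeasure s = ∫ ω, X (s, ω) ∂σ.stepsMeasure s :=
  integral_map (by fun_prop) hX.aestronglyMeasurable

/-- If `v` decreases in expectation in each discounted step of `σ` outside `T`, then the expected
discounted terminal reward is at most the initial value. -/
theorem integral_discountedReach_le (σ : M.Scheduler) (s : S) (T : Set S) {v : S → ℝ} {γ : ℝ}
    (h0 : 0 ≤ γ) (h1 : γ < 1)
    (h : ∀ π : FinPath S Act, π.last ∉ T → γ * ∑ p, (σ.step π p).toReal * v p.2 ≤ v π.last) :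
    ∫ π, discountedReach γ T v π ∂σ.pathMeasure s ≤ v s := by
  classical
  have hint (n : ℕ) : Integrable (fun π => stoppedReward γ T v π n) (σ.pathMeasure s) :=
    .of_bound (measurable_stoppedReward γ T v n).aestronglyMeasurable _
      (ae_of_all _ fun π => abs_stoppedReward_le h0 h1.le v π n)
  have hstep (n : ℕ) : ∫ π, stoppedReward γ T v π n ∂σ.pathMeasure s ≤ v s := by
    induction n with
    | zero =>
      rw [integral_pathMeasure σ s (measurable_stoppedReward γ T v 0)]
      simp [stoppedReward, state]
    | succ n ih =>
      refine le_trans ?_ ih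
      rw [← sub_nonpos, ← integral_sub (hint _) (hint _),
        integral_pathMeasure σ s (X := fun π => stoppedReward γ T v π (n + 1) -
          stoppedReward γ T v π n)
          ((measurable_stoppedReward γ T v _).sub (measurable_stoppedReward γ T v _))]
      -- The increment of the stopped process at time n, as a function of the prefix and the next
      -- step; its conditional expectation is nonpositive.
      have key := integral_stepsMeasure_step σ s n fun l p =>
        if s ∉ T ∧ ∀ q ∈ l, q.2 ∉ T then γ ^ n * (γ * v p.2 - v (FinPath.last ⟨s, l⟩)) else 0
      simp only [forall_notMem_prefix, last_prefix] at key
      simp only [stoppedReward, add_sub_cancel_left]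
      refine key.trans_le (integral_nonpos fun ω => ?_)
      by_cases hω : ∀ k ≤ n, state (s, ω) k ∉ T
      · simp only [if_pos hω]
        have h2 := h ⟨s, List.ofFn fun i : Fin n => ω i⟩
        rw [last_prefix] at h2
        have h3 := sum_toReal_pmf (σ.step ⟨s, List.ofFn fun i : Fin n => ω i⟩)
        calc _ = γ ^ n * (γ * ∑ p, (σ.step ⟨s, List.ofFn fun i : Fin n => ω i⟩ p).toReal * v p.2
              - (∑ p, (σ.step ⟨s, List.ofFn fun i : Fin n => ω i⟩ p).toReal)
                * v (state (s, ω) n)) := by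
              rw [Finset.mul_sum, Finset.sum_mul, ← Finset.sum_sub_distrib, Finset.mul_sum]
              exact Finset.sum_congr rfl fun _ _ => by ring
          _ ≤ 0 := by
              rw [h3, one_mul]
              exact mul_nonpos_of_nonneg_of_nonpos (pow_nonneg h0 n)
                (sub_nonpos.2 (h2 (hω n le_rfl)))
      · simp [if_neg hω]
  refine le_of_tendsto (tendsto_integral_of_dominated_convergence (fun _ => ∑ s, |v s|)
    (fun n => (hint n).aestronglyMeasurable) (integrable_const _)
    (fun n => ae_of_all _ fun π => abs_stoppedReward_le h0 h1.le v π n)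
    (ae_of_all _ fun π => tendsto_stoppedReward h0 h1 v π)) (Eventually.of_forall hstep)

/-- Discounted reachability is maximized by a memoryless deterministic scheduler. -/
theorem exists_policy_discountedReach (M : MDP S Act) (T : Set S) (f : S → ℝ) {γ : ℝ}
    (h0 : 0 ≤ γ) (h1 : γ < 1) :
    ∃ d : ∀ s, {a // M.Enabled s a}, ∀ (σ : M.Scheduler) (s : S),
      ∫ π, discountedReach γ T f π ∂σ.pathMeasure s ≤
        ∫ π, discountedReach γ T f π ∂(ofPolicy d).pathMeasure s := by
  obtain ⟨v, hvT, hv, d, hd⟩ := M.exists_discounted_optimality_equation T f h0 h1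
  refine ⟨d, fun σ s => ?_⟩
  simp only [← discountedReach_congr hvT]
  refine (integral_discountedReach_le σ s T h0 h1 fun π hπ =>
    mul_sum_step_le σ π fun a ha => hv _ hπ a ha).trans ?_
  -- The greedy policy satisfies the optimality equation with equality, so the same bound applied to
  -- -v gives the reverse inequality.
  have := integral_discountedReach_le (ofPolicy d) s T (v := -v) h0 h1 fun π hπ => by
    rw [sum_step_ofPolicy_mul, Pi.neg_apply, hd _ hπ]
    simp
  simp only [discountedReach_neg, integral_neg, Pi.neg_apply] at this
  exact neg_le_neg_iff.1 this

/-- For each scheduler there is a memoryless deterministic one with at least the same expected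
terminal reward. -/
theorem exists_policy_ge (σ : M.Scheduler) (s : S) (T : Set S) (f : S → ℝ) :
    ∃ d : ∀ s, {a // M.Enabled s a}, ∫ π, discountedReach 1 T f π ∂σ.pathMeasure s ≤
      ∫ π, discountedReach 1 T f π ∂(ofPolicy d).pathMeasure s := by
  choose d hd using fun n : ℕ =>
    exists_policy_discountedReach M T f (one_sub_inv_nonneg n) (one_sub_inv_lt_one n)
  have hlim (σ : M.Scheduler) := tendsto_integral_of_dominated_convergence
    (μ := σ.pathMeasure s) (fun _ => ∑ s, |f s|)
    (fun n : ℕ => (measurable_discountedReach (Act := Act) (one_sub_inv_nonneg n)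
      (one_sub_inv_lt_one n).le T f).aestronglyMeasurable) (integrable_const _)
    (fun n => ae_of_all _ fun π =>
      abs_discountedReach_le (one_sub_inv_nonneg n) (one_sub_inv_lt_one n).le f π)
    (ae_of_all _ fun π => tendsto_discountedReach_one tendsto_one_sub_inv f π)
  have : Finite (∀ s, {a // M.Enabled s a}) := inferInstance
  -- Pigeonhole: d₀ is optimal for infinitely many discount factors, and an inequality holding
  -- frequently passes to the limits.
  obtain ⟨d₀, hd₀⟩ := Finite.exists_infinite_fiber d
  refine ⟨d₀, le_of_tendsto_of_tendsto_of_frequently (hlim σ) (hlim (ofPolicy d₀)) ?_⟩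
  refine (Nat.frequently_atTop_iff_infinite.2 (Set.infinite_coe_iff.1 hd₀)).mono fun n hn => ?_
  have := hd n σ s
  rwa [show d n = d₀ from hn] at this

end Scheduler

end MDP

/-! ### Pair variance and one-sided improvement -/

namespace MDP

open InfPath Scheduler

variable {S Act : Type*} [Fintype S] [Fintype Act]
  [MeasurableSpace S] [MeasurableSingletonClass S]
  [MeasurableSpace Act] [MeasurableSingletonClass Act] {M : MDP S Act}

theorem pairVariance_eq {X : InfPath S Act → ℝ} (hX : Measurable X) {C : ℝ}
    (hC : ∀ π, |X π| ≤ C) (σ τ : M.Scheduler) :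
    M.pairVariance X σ τ = 1 / 2 * (∫ π, X π ^ 2 ∂σ.pathMeasure M.init -
      2 * (∫ π, X π ∂σ.pathMeasure M.init) * ∫ π, X π ∂τ.pathMeasure M.init +
      ∫ π, X π ^ 2 ∂τ.pathMeasure M.init) := by
  have hfst : Measurable (InfPath.fst : InfPath (S × S) (Act × Act) → InfPath S Act) := by
    unfold InfPath.fst; fun_prop
  have hsnd : Measurable (InfPath.snd : InfPath (S × S) (Act × Act) → InfPath S Act) := by
    unfold InfPath.snd; fun_prop
  have hint (σ : M.Scheduler) : Integrable X (σ.pathMeasure M.init) :=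
    .of_bound hX.aestronglyMeasurable C (ae_of_all _ hC)
  have hint2 (σ : M.Scheduler) : Integrable (fun π => X π ^ 2) (σ.pathMeasure M.init) :=
    .of_bound (hX.pow_const 2).aestronglyMeasurable (C ^ 2) (ae_of_all _ fun π => by
      rw [Real.norm_eq_abs, abs_pow]
      exact pow_le_pow_left₀ (abs_nonneg _) (hC π) 2)
  have hmap : ∫ π, (X π.fst - X π.snd) ^ 2 ∂(σ.prod τ).pathMeasure (M.prod M).init =
      ∫ z, (X z.1 - X z.2) ^ 2 ∂(σ.pathMeasure M.init).prod (τ.pathMeasure M.init) := by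
    have hm : Measurable fun z : InfPath S Act × InfPath S Act => (X z.1 - X z.2) ^ 2 :=
      ((hX.comp measurable_fst).sub (hX.comp measurable_snd)).pow_const 2
    have := integral_map (μ := (σ.prod τ).pathMeasure (M.prod M).init)
      (hfst.prodMk hsnd).aemeasurable hm.aestronglyMeasurable
    rw [pathMeasure_prod_map] at this
    exact this.symm
  have h1 := (hint2 σ).comp_fst (τ.pathMeasure M.init)
  have h2 := (hint2 τ).comp_snd (σ.pathMeasure M.init)
  have h3 := ((hint σ).mul_prod (hint τ)).const_mul 2
  have hexp : (fun z : InfPath S Act × InfPath S Act => (X z.1 - X z.2) ^ 2) =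
      fun z => X z.1 ^ 2 - 2 * (X z.1 * X z.2) + X z.2 ^ 2 := by
    ext z; ring
  rw [pairVariance, hmap, hexp, integral_add (f := fun z => X z.1 ^ 2 - 2 * (X z.1 * X z.2))
    (h1.sub h3) h2, integral_sub h1 h3,
    integral_fun_fst (fun π => X π ^ 2), integral_fun_snd (fun π => X π ^ 2),
    integral_const_mul 2, integral_prod_mul]
  simp only [probReal_univ, one_smul]
  ring

theorem pairVariance_comm {X : InfPath S Act → ℝ} (hX : Measurable X) {C : ℝ}
    (hC : ∀ π, |X π| ≤ C) (σ τ : M.Scheduler) :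
    M.pairVariance X σ τ = M.pairVariance X τ σ := by
  rw [pairVariance_eq hX hC, pairVariance_eq hX hC]
  ring

/-- For fixed τ the variance is, up to a constant and the factor ½, the expectation under σ of a
terminal reward, so `exists_policy_ge` applies. -/
theorem exists_policy_pairVariance_ge (T : Set S) (f : S → ℝ) (σ τ : M.Scheduler) :
    ∃ d : ∀ s, {a // M.Enabled s a}, M.pairVariance (discountedReach 1 T f) σ τ ≤
      M.pairVariance (discountedReach 1 T f) (ofPolicy d) τ := by
  have hX := measurable_discountedReach (Act := Act) zero_le_one le_rfl T f
  have hC := abs_discountedReach_le (Act := Act) (T := T) zero_le_one le_rfl f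
  have hint (σ : M.Scheduler) (f : S → ℝ) :
      Integrable (discountedReach 1 T f) (σ.pathMeasure M.init) :=
    .of_bound (measurable_discountedReach zero_le_one le_rfl T f).aestronglyMeasurable _
      (ae_of_all _ (abs_discountedReach_le zero_le_one le_rfl f))
  set c := ∫ π, discountedReach 1 T f π ∂τ.pathMeasure M.init with hc
  -- This needs γ = 1: otherwise squaring would also square the discount.
  have hsq (π : InfPath S Act) :
      discountedReach 1 T f π ^ 2 = discountedReach 1 T (fun s => f s ^ 2) π := by
    rcases forall_notMem_or_exists_first T π with hπ | ⟨N, hπ, hN⟩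
    · simp [discountedReach_of_forall_notMem hπ]
    · simp [discountedReach_of_mem hπ hN]
  have hlin (π : InfPath S Act) : discountedReach 1 T (fun s => f s ^ 2 - 2 * c * f s) π =
      discountedReach 1 T (fun s => f s ^ 2) π - 2 * c * discountedReach 1 T f π := by
    rcases forall_notMem_or_exists_first T π with hπ | ⟨N, hπ, hN⟩
    · simp [discountedReach_of_forall_notMem hπ]
    · simp [discountedReach_of_mem hπ hN]
  obtain ⟨d, hd⟩ := exists_policy_ge σ M.init T fun s => f s ^ 2 - 2 * c * f s
  refine ⟨d, ?_⟩
  simp only [hlin] at hd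
  rw [integral_sub (hint _ _) ((hint _ _).const_mul _), integral_const_mul,
    integral_sub (hint _ _) ((hint _ _).const_mul _), integral_const_mul] at hd
  rw [pairVariance_eq hX hC, pairVariance_eq hX hC]
  simp only [hsq, ← hc]
  linarith

end MDP

open Classical in
theorem weightedReach_eq_discountedReach {S Act : Type*} (T : Set S) (wgt : T → ℚ) :
    weightedReach (Act := Act) T wgt =
      InfPath.discountedReach 1 T fun s => if hs : s ∈ T then (wgt ⟨s, hs⟩ : ℝ) else 0 := by
  ext π
  by_cases h : ∃ n, InfPath.state π n ∈ T
  · rw [weightedReach, InfPath.discountedReach, dif_pos h, dif_pos h, one_pow, one_mul,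
      dif_pos (Nat.find_spec h)]
  · rw [weightedReach, InfPath.discountedReach, dif_neg h, dif_neg h]

theorem mainTheorem9 {S Act : Type*} [Fintype S] [Fintype Act]
    [MeasurableSpace S] [MeasurableSingletonClass S]
    [MeasurableSpace Act] [MeasurableSingletonClass Act]
    (M : MDP S Act) (T : Set S) (hT : ∀ t ∈ T, M.Absorbing t) (wgt : T → ℚ) :
    ∃ σ τ : M.Scheduler,
      (σ.Memoryless ∧ σ.Deterministic) ∧ (τ.Memoryless ∧ τ.Deterministic) ∧
      M.demonicVariance (weightedReach T wgt) =
        ((M.pairVariance (weightedReach T wgt) σ τ : ℝ) : EReal) := by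
  classical
  rw [weightedReach_eq_discountedReach]
  set f : S → ℝ := fun s => if hs : s ∈ T then (wgt ⟨s, hs⟩ : ℝ) else 0
  have hX := InfPath.measurable_discountedReach (Act := Act) zero_le_one le_rfl T f
  have hC := InfPath.abs_discountedReach_le (Act := Act) (T := T) zero_le_one le_rfl f
  have : Nonempty (∀ s, {a // M.Enabled s a}) :=
    ⟨fun s => ⟨(M.exists_enabled s).choose, (M.exists_enabled s).choose_spec⟩⟩
  obtain ⟨⟨d, e⟩, hmax⟩ := Finite.exists_max
    fun z : (∀ s, {a // M.Enabled s a}) × (∀ s, {a // M.Enabled s a}) =>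
      M.pairVariance (InfPath.discountedReach 1 T f) (.ofPolicy z.1) (.ofPolicy z.2)
  refine ⟨.ofPolicy d, .ofPolicy e,
    ⟨MDP.Scheduler.ofPolicy_memoryless d, MDP.Scheduler.ofPolicy_deterministic d⟩,
    ⟨MDP.Scheduler.ofPolicy_memoryless e, MDP.Scheduler.ofPolicy_deterministic e⟩,
    le_antisymm (iSup₂_le fun σ τ => EReal.coe_le_coe_iff.2 ?_) (le_iSup₂_of_le _ _ le_rfl)⟩
  -- The second replacement is made against the already improved first scheduler, with the roles
  -- exchanged by symmetry.
  obtain ⟨d', hd'⟩ := MDP.exists_policy_pairVariance_ge T f σ τ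
  obtain ⟨e', he'⟩ := MDP.exists_policy_pairVariance_ge T f τ (.ofPolicy d')
  rw [MDP.pairVariance_comm hX hC, MDP.pairVariance_comm hX hC (.ofPolicy e')] at he'
  exact hd'.trans (he'.trans (hmax (d', e')))
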